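/- Let $0<q<1$, let $\theta,\phi$ be nonzero real numbers, and let $N,n_1,n_2$ be non-negative integers with $n_1+n_2\le N$. Write $(a;q)_n=\prod_{i=0}^{n-1}(1-aq^i)$, and let $$k_n(x;p,M;q)=(-1)^n\,(q^{-M};q)_n\,q^{\binom n2}\;{}_2\phi_1\!\left(\begin{matrix}q^{-n},\,q^{-x}\\ q^{-M}\end{matrix};\,q,\;p\,q^{n+1}\right)$$ be the quantum $q$-Krawtchouk polynomials, where ${}_2\phi_1\left(\begin{smallmatrix}a,\,b\\ c\end{smallmatrix};q,z\right)=\sum_{k\ge0}\frac{(a;q)_k(b;q)_k}{(q;q)_k(c;q)_k}z^k$. Let $$K_{n_1,n_2}(x_1,x_2)=k_{n_1}(x_1;\theta^{-2},x_1+x_2;q)\;k_{n_2}(x_1+x_2-n_1;\phi^{-2},N-n_1;q)$$ be the two-variable quantum $q$-Krawtchouk polynomials. At integers $x_1,x_2\ge 0$ with $x_1+x_2<n_1$ the first factor is $0$, since $(q^{-x_1-x_2};q)_{n_1}=0$ and the series stops at $k=x_1$. Call $(x_1,x_2)$ a grid point if $x_1,x_2$ are non-negative integers with $x_1+x_2\le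 N$; at such points a term whose coefficient vanishes and which refers to a point outside the grid is read as $0$. (1) If $(x_1,x_2)$ is a grid point, or if $x_1,x_2$ are real numbers with $x_1+x_2\notin\{0,\dots,n_1-1\}$, then the 3-point equation holds: $$\begin{aligned}q^{n_1}K_{n_1,n_2}(x_1,x_2)={}&\left[q^{x_1}(1+\theta^2)+q^{-1}\theta^2q^{-x_2}-(1+q^{-1})\theta^2q^{x_1-x_2}\right]K_{n_1,n_2}(x_1,x_2)\\&+(1-\theta^2q^{-x_2-1})(1-q^{x_1})\,K_{n_1,n_2}(x_1-1,x_2+1)\\&+\theta^2q^{x_1-x_2}(1-q^{x_2})\,K_{n_1,n_2}(x_1+1,x_2-1).\end{aligned}$$ (2) If $(x_1,x_2)$ is a grid point, or if $x_1,x_2$ are real numbers such that none of $x_1+x_2-1,\ x_1+x_2,\ x_1+x_2+1$ lies in $\{0,\dots,n_1-1\}$, then the 7-point equation holds: $$\begin{aligned}q^{n_1+n_2}K_{n_1,n_2}(x_1,x_2)={}&\Big[q^{x_1+x_2}\left(1-(1+q^{-1})\phi^2q^{x_1+x_2-N}+\phi^2\right)\\&\quad+q^{-1}\phi^2q^{2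x_1+x_2-N}\left(1-(1+q^{-1})\theta^2q^{-x_2}+\theta^2+q^{-1}\theta^2q^{-(x_1+x_2)}\right)\Big]K_{n_1,n_2}(x_1,x_2)\\&+\phi^2q^{x_1+x_2-N-1}(1-q^{x_1})(1-\theta^2q^{-x_2-1})\,K_{n_1,n_2}(x_1-1,x_2+1)\\&+\theta^2\phi^2q^{2x_1-N-1}(1-q^{x_2})\,K_{n_1,n_2}(x_1+1,x_2-1)\\&+q^{x_1}(1-q^{x_2})(1-\phi^2q^{x_1+x_2-N-1})\,K_{n_1,n_2}(x_1,x_2-1)\\&-\phi^2q^{x_1+x_2}(1-q^{x_1+x_2-N})(1-\theta^2q^{-x_2-1})\,K_{n_1,n_2}(x_1,x_2+1)\\&+(1-q^{x_1})(1-\phi^2q^{x_1+x_2-N-1})\,K_{n_1,n_2}(x_1-1,x_2)\\&-\theta^2\phi^2q^{x_1-1}(1-q^{x_1+x_2-N})\,K_{n_1,n_2}(x_1+1,x_2).\end{aligned}$$ -/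

import Mathlib

noncomputable section

namespace QKrawtchouk

/-- The q-Pochhammer symbol `(a;q)_n = (1-a)(1-aq)⋯(1-aq^{n-1})`, with `(a;q)_0 = 1`. -/
def qPochhammer (a q : ℝ) (n : ℕ) : ℝ :=
  ∏ i ∈ Finset.range n, (1 - a * q ^ i)

/-- The basic hypergeometric series `ᵣφₛ(a₁,…,aᵣ; b₁,…,bₛ; q, z)`, with
`as = [a₁,…,aᵣ]` and `bs = [b₁,…,bₛ]`. -/
def basicHypergeometric (as bs : List ℝ) (q z : ℝ) : ℝ :=
  ∑' k : ℕ,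
    (as.map fun a => qPochhammer a q k).prod /
        (qPochhammer q q k * (bs.map fun b => qPochhammer b q k).prod) *
      ((-1 : ℝ) ^ k * q ^ k.choose 2) ^ (1 + (bs.length : ℤ) - (as.length : ℤ)) * z ^ k

/-- The univariate quantum q-Krawtchouk polynomial
`k_n(x;p,M;q) = (-1)^n (q^{-M};q)_n q^{n(n-1)/2} ₂φ₁(q^{-n}, q^{-x}; q^{-M}; q, p q^{n+1})`.
The arguments `x` and `M` are real, so `q ^ (-x)` and `q ^ (-M)` are real powers. The series
terminates since `(q^{-n};q)_k = 0` for `k > n`. -/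
def quantumKrawtchouk (q : ℝ) (n : ℕ) (x p M : ℝ) : ℝ :=
  (-1 : ℝ) ^ n * qPochhammer (q ^ (-M)) q n * q ^ n.choose 2 *
    basicHypergeometric [q ^ (-(n : ℝ)), q ^ (-x)] [q ^ (-M)] q (p * q ^ (n + 1))

/-- The two-variable quantum q-Krawtchouk polynomial
`K_{n₁,n₂}(x₁,x₂;α₁,α₂;N) =
  k_{n₁}(x₁; α₁^{-2}, x₁+x₂; q) k_{n₂}(x₁+x₂-n₁; α₂^{-2}, N-n₁; q)`. -/
def bivariateKrawtchouk (q : ℝ) (n₁ n₂ : ℕ) (x₁ x₂ α₁ α₂ : ℝ) (N : ℕ) : ℝ :=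
  quantumKrawtchouk q n₁ x₁ (α₁ ^ (-2 : ℤ)) (x₁ + x₂) *
    quantumKrawtchouk q n₂ (x₁ + x₂ - n₁) (α₂ ^ (-2 : ℤ)) ((N : ℝ) - n₁)

/-- `(x₁,x₂)` is a point of the triangular grid of non-negative integer points with
`x₁ + x₂ ≤ N`. -/
def IsGridPoint (N : ℕ) (x₁ x₂ : ℝ) : Prop :=
  ∃ m₁ m₂ : ℕ, m₁ + m₂ ≤ N ∧ x₁ = m₁ ∧ x₂ = m₂

/-- The real number `s` is none of `0, 1, …, n-1`. For `0 < q < 1` this says that the symbol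
`(q^{-s};q)_n` does not vanish, so that no denominator in the definition of
`k_n(x;p,s;q)` vanishes. -/
def IsRegularSum (n : ℕ) (s : ℝ) : Prop :=
  ∀ j : ℕ, j < n → s ≠ j

end QKrawtchouk

end

/-!
The terminating series defining `k_n(x;p,s;q)` can be multiplied by the prefactor `(q^{-s};q)_n`
term by term, which gives an expression `clearedKrawtchouk` that is a polynomial in `X = q^{-x}` and
`Y = q^{-s}`, hence has no singular points. It agrees with `k_n` when `s ∉ {0,…,n-1}`, and both vanish
at integers `0 ≤ x ≤ s < n`; so `K` may be replaced by a product of two such polynomials at every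
point that carries a nonzero coefficient.

The cleared polynomials satisfy two contiguous relations, one lowering `s` by one
(`krawtchoukAt_lower`) and one raising it (`krawtchoukAt_raise`); each is checked by comparing
coefficients of powers of `p`. Composing them gives the three-term `q`-difference equation in `x`
(`krawtchoukAt_difference`), which is the 3-point equation, since the second factor of `K` depends
on `x₁ + x₂` only.

For the 7-point equation, apply the three-term equation to the second factor `B(s)`, with
`s = x₁ + x₂`, and multiply by `q^{n₁} A(x₁,s)`. The coefficients of `B(s-1)`, `B(s+1)` and `B(s)`
contain `(q^{n₁} - q^s) A(x₁,s)`, `A(x₁,s)` and `q^{n₁} A(x₁,s)`, which are rewritten by the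
lowering relation, the raising relation and the three-term equation respectively.
-/

namespace QKrawtchouk

/-! ### The q-Pochhammer symbol -/

theorem qPochhammer_zero (a q : ℝ) : qPochhammer a q 0 = 1 := by
  simp [qPochhammer]

theorem qPochhammer_succ (a q : ℝ) (n : ℕ) :
    qPochhammer a q (n + 1) = qPochhammer a q n * (1 - a * q ^ n) := by
  simp [qPochhammer, Finset.prod_range_succ]

theorem qPochhammer_succ' (a q : ℝ) (n : ℕ) :
    qPochhammer a q (n + 1) = (1 - a) * qPochhammer (a * q) q n := by
  simp [qPochhammer, Finset.prod_range_succ', pow_succ', mul_assoc, mul_comm]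

theorem qPochhammer_add (a q : ℝ) (k m : ℕ) :
    qPochhammer a q (k + m) = qPochhammer a q k * qPochhammer (a * q ^ k) q m := by
  simp [qPochhammer, Finset.prod_range_add, pow_add, mul_assoc]

theorem qPochhammer_eq_zero {a q : ℝ} {n i : ℕ} (hi : i < n) (h : a * q ^ i = 1) :
    qPochhammer a q n = 0 :=
  Finset.prod_eq_zero (Finset.mem_range.2 hi) (by rw [h, sub_self])

theorem rpow_neg_natCast_mul_pow {q : ℝ} (hq : 0 < q) (n : ℕ) : q ^ (-(n : ℝ)) * q ^ n = 1 := by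
  rw [Real.rpow_neg hq.le, Real.rpow_natCast, inv_mul_cancel₀ (pow_pos hq n).ne']

theorem qPochhammer_self_ne_zero {q : ℝ} (hq0 : 0 < q) (hq1 : q < 1) (k : ℕ) :
    qPochhammer q q k ≠ 0 := by
  refine Finset.prod_ne_zero_iff.2 fun i _ => ?_
  rw [← pow_succ']
  exact (sub_pos.2 (pow_lt_one₀ hq0.le hq1 i.succ_ne_zero)).ne'

theorem qPochhammer_rpow_neg_ne_zero {q : ℝ} (hq0 : 0 < q) (hq1 : q < 1) {n : ℕ} {s : ℝ}
    (hs : IsRegularSum n s) : qPochhammer (q ^ (-s)) q n ≠ 0 := by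
  refine Finset.prod_ne_zero_iff.2 fun i hi h => hs i (Finset.mem_range.1 hi) ?_
  rw [← Real.rpow_natCast, ← Real.rpow_add hq0, sub_eq_zero] at h
  have h' := congrArg Real.log h
  rw [Real.log_one, Real.log_rpow hq0] at h'
  have := (mul_eq_zero.1 h'.symm).resolve_right (Real.log_neg hq0 hq1).ne
  linarith

/-! ### Quantum q-Krawtchouk polynomials with cleared denominators -/

/-- The coefficient `(q^{-n};q)_k / (q;q)_k (p q^{n+1})^k` of the series defining `k_n`. -/
noncomputable def krawtchoukCoeff (q : ℝ) (n : ℕ) (p : ℝ) (k : ℕ) : ℝ :=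
  qPochhammer (q ^ (-(n : ℝ))) q k / qPochhammer q q k * (p * q ^ (n + 1)) ^ k

/-- The polynomial in `X` and `Y` obtained from `k_n(x;p,s;q)`, where `X = q^{-x}` and `Y = q^{-s}`,
by replacing the quotient `(Y;q)_n / (Y;q)_k` in each term by `(Y q^k;q)_{n-k}`. -/
noncomputable def clearedKrawtchouk (q : ℝ) (n : ℕ) (p X Y : ℝ) : ℝ :=
  (-1 : ℝ) ^ n * q ^ n.choose 2 *
    ∑ k ∈ Finset.range (n + 1),
      krawtchoukCoeff q n p k * (qPochhammer X q k * qPochhammer (Y * q ^ k) q (n - k))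

/-- The polynomial `clearedKrawtchouk` at `X = q^{-x}`, `Y = q^{-s}`. -/
noncomputable def krawtchoukAt (q : ℝ) (n : ℕ) (p x s : ℝ) : ℝ :=
  clearedKrawtchouk q n p (q ^ (-x)) (q ^ (-s))

theorem krawtchoukCoeff_succ {q : ℝ} (hq0 : 0 < q) (hq1 : q < 1) {n k : ℕ} (hk : k < n)
    (p : ℝ) :
    krawtchoukCoeff q n p (k + 1) * (1 - q ^ (k + 1)) =
      -krawtchoukCoeff q n p k * (p * q ^ (k + 1) * (1 - q ^ (n - k))) := by
  obtain ⟨m, rfl⟩ := Nat.exists_eq_add_of_lt hk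
  have h1 := qPochhammer_self_ne_zero hq0 hq1 k
  have h2 : 1 - q * q ^ k ≠ 0 := by
    rw [← pow_succ']
    exact (sub_pos.2 (pow_lt_one₀ hq0.le hq1 k.succ_ne_zero)).ne'
  have h3 : q ^ (-((k + m + 1 : ℕ) : ℝ)) = (q ^ (k + m + 1))⁻¹ := by
    rw [Real.rpow_neg hq0.le, Real.rpow_natCast]
  have h4 : k + m + 1 - k = m + 1 := by omega
  have hq := hq0.ne'
  simp only [krawtchoukCoeff, qPochhammer_succ, h4]
  clear hk
  generalize qPochhammer (q ^ (-((k + m + 1 : ℕ) : ℝ))) q k = c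
  rw [h3, pow_succ (p * q ^ (k + m + 1 + 1)) k]
  generalize (p * q ^ (k + m + 1 + 1)) ^ k = w
  simp only [pow_succ, pow_add]
  rw [mul_comm (q ^ k) q]
  have hk := pow_ne_zero k hq
  have hm := pow_ne_zero m hq
  generalize q ^ k = r at *
  generalize q ^ m = t at *
  generalize 1 - q * r = d at *
  field_simp
  ring

theorem clearedKrawtchouk_lower (q : ℝ) (n : ℕ) (p : ℝ) {X : ℝ} (hX : X ≠ 0) (Y : ℝ) :
    (Y * q ^ n - 1) * clearedKrawtchouk q n p X Y =
      (Y / X - 1) * clearedKrawtchouk q n p X (Y * q) +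
        (Y - Y / X) * clearedKrawtchouk q n p (X * q) (Y * q) := by
  have key : ∀ k ∈ Finset.range (n + 1),
      (Y * q ^ n - 1) * (krawtchoukCoeff q n p k *
          (qPochhammer X q k * qPochhammer (Y * q ^ k) q (n - k))) =
        (Y / X - 1) * (krawtchoukCoeff q n p k *
          (qPochhammer X q k * qPochhammer (Y * q * q ^ k) q (n - k))) +
        (Y - Y / X) * (krawtchoukCoeff q n p k *
          (qPochhammer (X * q) q k * qPochhammer (Y * q * q ^ k) q (n - k))) := by
    intro k hk
    obtain ⟨m, rfl⟩ := Nat.exists_eq_add_of_le (Nat.lt_succ_iff.1 (Finset.mem_range.1 hk))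
    have hY := (qPochhammer_succ (Y * q ^ k) q m).symm.trans (qPochhammer_succ' (Y * q ^ k) q m)
    have hXk := (qPochhammer_succ X q k).symm.trans (qPochhammer_succ' X q k)
    rw [mul_right_comm Y q, Nat.add_sub_cancel_left, pow_add]
    field_simp
    linear_combination (-krawtchoukCoeff q (k + m) p k * qPochhammer X q k * X) * hY -
      (krawtchoukCoeff q (k + m) p k * Y * qPochhammer (Y * q ^ k * q) q m) * hXk
  have hsum := Finset.sum_congr rfl key
  rw [Finset.sum_add_distrib, ← Finset.mul_sum, ← Finset.mul_sum, ← Finset.mul_sum] at hsum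
  unfold clearedKrawtchouk
  linear_combination (-1 : ℝ) ^ n * q ^ n.choose 2 * hsum

theorem clearedKrawtchouk_raise {q : ℝ} (hq0 : 0 < q) (hq1 : q < 1) (n : ℕ) {p T : ℝ}
    (hT : T * p = 1) {X : ℝ} (hX : X ≠ 0) (Y : ℝ) :
    clearedKrawtchouk q n p (X * q) (Y * q) =
      (1 - T * (Y / (X * q))) * clearedKrawtchouk q n p (X * q) Y +
        T * (Y / (X * q)) * clearedKrawtchouk q n p X Y := by
  have hq := hq0.ne'
  -- The `k`-th term on the left, which vanishes for `k = n`, matches the `(k+1)`-st on the right.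
  have key : ∀ k ∈ Finset.range n,
      krawtchoukCoeff q n p k * (qPochhammer (X * q) q k *
          (qPochhammer (Y * q * q ^ k) q (n - k) - qPochhammer (Y * q ^ k) q (n - k))) =
        T * (Y / (X * q)) * (krawtchoukCoeff q n p (k + 1) *
          ((qPochhammer X q (k + 1) - qPochhammer (X * q) q (k + 1)) *
            qPochhammer (Y * q ^ (k + 1)) q (n - (k + 1)))) := by
    intro k hk
    have hk' := Finset.mem_range.1 hk
    have hc := krawtchoukCoeff_succ hq0 hq1 hk' p
    obtain ⟨m, rfl⟩ := Nat.exists_eq_add_of_lt hk'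
    have e1 : k + m + 1 - k = m + 1 := by omega
    have e2 : k + m + 1 - (k + 1) = m := by omega
    rw [e1] at hc
    rw [e1, e2, mul_right_comm Y q, qPochhammer_succ (Y * q ^ k * q), qPochhammer_succ' (Y * q ^ k),
      qPochhammer_succ' X, qPochhammer_succ (X * q), show Y * q ^ (k + 1) = Y * q ^ k * q by ring]
    generalize qPochhammer (X * q) q k = a
    generalize qPochhammer (Y * q ^ k * q) q m = b
    rw [pow_succ, pow_succ] at hc
    field_simp
    linear_combination (T * a * b * Y * X) * hc -
      (a * b * Y * X * krawtchoukCoeff q (k + m + 1) p k * q ^ k * q * (1 - q ^ m * q)) * hT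
  have hsum := Finset.sum_congr rfl key
  rw [← Finset.mul_sum] at hsum
  have hl : ∑ k ∈ Finset.range (n + 1), krawtchoukCoeff q n p k * (qPochhammer (X * q) q k *
      (qPochhammer (Y * q * q ^ k) q (n - k) - qPochhammer (Y * q ^ k) q (n - k))) =
      ∑ k ∈ Finset.range n, krawtchoukCoeff q n p k * (qPochhammer (X * q) q k *
      (qPochhammer (Y * q * q ^ k) q (n - k) - qPochhammer (Y * q ^ k) q (n - k))) := by
    rw [Finset.sum_range_succ]
    simp [qPochhammer_zero]
  have hr : ∑ k ∈ Finset.range (n + 1), krawtchoukCoeff q n p k *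
      ((qPochhammer X q k - qPochhammer (X * q) q k) * qPochhammer (Y * q ^ k) q (n - k)) =
      ∑ k ∈ Finset.range n, krawtchoukCoeff q n p (k + 1) *
      ((qPochhammer X q (k + 1) - qPochhammer (X * q) q (k + 1)) *
        qPochhammer (Y * q ^ (k + 1)) q (n - (k + 1))) := by
    rw [Finset.sum_range_succ']
    simp [qPochhammer_zero]
  rw [← hl, ← hr] at hsum
  simp only [mul_sub, sub_mul, Finset.sum_sub_distrib] at hsum
  unfold clearedKrawtchouk
  linear_combination (-1 : ℝ) ^ n * q ^ n.choose 2 * hsum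

/-! ### Contiguous relations and the difference equation -/

theorem krawtchoukAt_lower {q : ℝ} (hq0 : 0 < q) (n : ℕ) (p x s : ℝ) :
    (q ^ n - q ^ s) * krawtchoukAt q n p x s =
      q ^ x * (1 - q ^ (s - x)) * krawtchoukAt q n p x (s - 1) +
        (1 - q ^ x) * krawtchoukAt q n p (x - 1) (s - 1) := by
  have h := clearedKrawtchouk_lower q n p (Real.rpow_pos_of_pos hq0 (-x)).ne' (q ^ (-s))
  have e (y : ℝ) : q ^ (-(y - 1)) = q ^ (-y) * q := by
    rw [neg_sub, sub_eq_neg_add, Real.rpow_add hq0, Real.rpow_one]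
  unfold krawtchoukAt
  rw [e, e, Real.rpow_sub hq0]
  have hx := (Real.rpow_pos_of_pos hq0 x).ne'
  have hs := (Real.rpow_pos_of_pos hq0 s).ne'
  have ex : q ^ (-x) = (q ^ x)⁻¹ := Real.rpow_neg hq0.le x
  have es : q ^ (-s) = (q ^ s)⁻¹ := Real.rpow_neg hq0.le s
  generalize clearedKrawtchouk q n p (q ^ (-x)) (q ^ (-s)) = a at *
  generalize clearedKrawtchouk q n p (q ^ (-x)) (q ^ (-s) * q) = b at *
  generalize clearedKrawtchouk q n p (q ^ (-x) * q) (q ^ (-s) * q) = c at *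
  rw [ex, es] at h
  field_simp at h ⊢
  linear_combination h

theorem krawtchoukAt_raise {q : ℝ} (hq0 : 0 < q) (hq1 : q < 1) (n : ℕ) {p T : ℝ}
    (hT : T * p = 1) (x s : ℝ) :
    krawtchoukAt q n p x s =
      (1 - T * q ^ (x - s - 1)) * krawtchoukAt q n p x (s + 1) +
        T * q ^ (x - s - 1) * krawtchoukAt q n p (x + 1) (s + 1) := by
  have h := clearedKrawtchouk_raise hq0 hq1 n hT
    (Real.rpow_pos_of_pos hq0 (-(x + 1))).ne' (q ^ (-(s + 1)))
  have e (y : ℝ) : q ^ (-(y + 1)) * q = q ^ (-y) := by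
    rw [← Real.rpow_add_one hq0.ne']
    congr 1
    ring
  have e' : q ^ (-(s + 1)) / q ^ (-x) = q ^ (x - s - 1) := by
    rw [← Real.rpow_sub hq0]
    congr 1
    ring
  rw [e, e, e'] at h
  exact h

/-- The three-term `q`-difference equation in `x`, obtained by applying the raising relation to both
terms on the right of the lowering relation. -/
theorem krawtchoukAt_difference {q : ℝ} (hq0 : 0 < q) (hq1 : q < 1) (n : ℕ) {p T : ℝ}
    (hT : T * p = 1) (x s : ℝ) :
    q ^ n * krawtchoukAt q n p x s =
      (q ^ x * (1 + T) + q⁻¹ * T * q ^ (x - s) - (1 + q⁻¹) * T * q ^ (2 * x - s)) *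
          krawtchoukAt q n p x s +
        (1 - T * q ^ (x - s - 1)) * (1 - q ^ x) * krawtchoukAt q n p (x - 1) s +
        T * q ^ (2 * x - s) * (1 - q ^ (s - x)) * krawtchoukAt q n p (x + 1) s := by
  have h0 := krawtchoukAt_lower hq0 n p x s
  have h1 := krawtchoukAt_raise hq0 hq1 n hT x (s - 1)
  have h2 := krawtchoukAt_raise hq0 hq1 n hT (x - 1) (s - 1)
  rw [sub_add_cancel] at h1 h2
  rw [sub_add_cancel] at h2
  have hq := hq0.ne'
  have hx := (Real.rpow_pos_of_pos hq0 x).ne'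
  have hs := (Real.rpow_pos_of_pos hq0 s).ne'
  have e2 : q ^ (2 * x) = q ^ x * q ^ x := by rw [two_mul, Real.rpow_add hq0]
  simp only [Real.rpow_sub hq0, Real.rpow_one, e2] at h0 h1 h2 ⊢
  rw [h1, h2] at h0
  field_simp at h0 ⊢
  linear_combination h0

/-! ### Agreement with the hypergeometric definition -/

theorem basicHypergeometric_eq_sum {q : ℝ} (hq0 : 0 < q) (n : ℕ) (b c z : ℝ) :
    basicHypergeometric [q ^ (-(n : ℝ)), b] [c] q z =
      ∑ k ∈ Finset.range (n + 1), qPochhammer (q ^ (-(n : ℝ))) q k * qPochhammer b q k /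
        (qPochhammer q q k * qPochhammer c q k) * z ^ k := by
  unfold basicHypergeometric
  rw [tsum_eq_sum (s := Finset.range (n + 1))]
  · simp
  · intro k hk
    have hk' : n < k := by simpa using hk
    rw [List.map_cons, List.prod_cons,
      qPochhammer_eq_zero hk' (rpow_neg_natCast_mul_pow hq0 n)]
    simp

theorem quantumKrawtchouk_eq_of_isRegularSum {q : ℝ} (hq0 : 0 < q) (hq1 : q < 1) {n : ℕ}
    {s : ℝ} (hs : IsRegularSum n s) (x p : ℝ) :
    quantumKrawtchouk q n x p s = krawtchoukAt q n p x s := by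
  unfold quantumKrawtchouk krawtchoukAt clearedKrawtchouk
  rw [basicHypergeometric_eq_sum hq0, mul_right_comm _ _ (q ^ n.choose 2), mul_assoc,
    Finset.mul_sum]
  congr 1
  refine Finset.sum_congr rfl fun k hk => ?_
  have hkn : k ≤ n := Nat.lt_succ_iff.1 (Finset.mem_range.1 hk)
  have h1 := qPochhammer_self_ne_zero hq0 hq1 k
  have h2 : qPochhammer (q ^ (-s)) q k ≠ 0 :=
    qPochhammer_rpow_neg_ne_zero hq0 hq1 fun j hj => hs j (hj.trans_le hkn)
  have h3 := qPochhammer_add (q ^ (-s)) q k (n - k)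
  rw [Nat.add_sub_cancel' hkn] at h3
  rw [h3, krawtchoukCoeff]
  field_simp

/-- If `m₁ ≤ s` are natural numbers, then also the degenerate case `s < n` is covered: there
`(q^{-s};q)_n = 0`, while the `k`-th term of the cleared sum contains the factor
`(q^{k-s};q)_{n-k} = 0` for `k ≤ s` and `(q^{-m₁};q)_k = 0` for `k > s`. -/
theorem quantumKrawtchouk_eq_of_natCast {q : ℝ} (hq0 : 0 < q) (hq1 : q < 1) (n : ℕ) {m₁ s : ℕ}
    (hm : m₁ ≤ s) (p : ℝ) :
    quantumKrawtchouk q n m₁ p s = krawtchoukAt q n p m₁ s := by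
  rcases le_or_gt n s with hs | hs
  · refine quantumKrawtchouk_eq_of_isRegularSum hq0 hq1 (fun j hj h => ?_) _ _
    have : s = j := by exact_mod_cast h
    omega
  · have h0 : qPochhammer (q ^ (-(s : ℝ))) q n = 0 :=
      qPochhammer_eq_zero hs (rpow_neg_natCast_mul_pow hq0 s)
    have hz : ∀ k ∈ Finset.range (n + 1), krawtchoukCoeff q n p k *
        (qPochhammer (q ^ (-(m₁ : ℝ))) q k *
          qPochhammer (q ^ (-(s : ℝ)) * q ^ k) q (n - k)) = 0 := by
      intro k _
      rcases le_or_gt k s with hk | hk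
      · rw [qPochhammer_eq_zero (a := q ^ (-(s : ℝ)) * q ^ k) (i := s - k) (by omega), mul_zero,
          mul_zero]
        rw [mul_assoc, ← pow_add, Nat.add_sub_cancel' hk, rpow_neg_natCast_mul_pow hq0]
      · rw [qPochhammer_eq_zero (hm.trans_lt hk) (rpow_neg_natCast_mul_pow hq0 m₁), zero_mul,
          mul_zero]
    rw [quantumKrawtchouk, krawtchoukAt, clearedKrawtchouk, Finset.sum_eq_zero hz, h0]
    simp

/-- The product of cleared polynomials that replaces `K_{n₁,n₂}`. -/
noncomputable def bivariateKrawtchoukAt (q : ℝ) (n₁ n₂ : ℕ) (x₁ x₂ α₁ α₂ : ℝ) (N : ℕ) : ℝ :=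
  krawtchoukAt q n₁ (α₁ ^ (-2 : ℤ)) x₁ (x₁ + x₂) *
    krawtchoukAt q n₂ (α₂ ^ (-2 : ℤ)) (x₁ + x₂ - n₁) ((N : ℝ) - n₁)

theorem isRegularSum_sub_natCast {N n₁ n₂ : ℕ} (hn : n₁ + n₂ ≤ N) :
    IsRegularSum n₂ ((N : ℝ) - n₁) := by
  intro j hj h
  have : N = j + n₁ := by exact_mod_cast sub_eq_iff_eq_add.1 h
  omega

theorem bivariateKrawtchouk_eq_of_isRegularSum {q : ℝ} (hq0 : 0 < q) (hq1 : q < 1)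
    {N n₁ n₂ : ℕ} (hn : n₁ + n₂ ≤ N) {x₁ x₂ : ℝ} (h : IsRegularSum n₁ (x₁ + x₂)) (α₁ α₂ : ℝ) :
    bivariateKrawtchouk q n₁ n₂ x₁ x₂ α₁ α₂ N = bivariateKrawtchoukAt q n₁ n₂ x₁ x₂ α₁ α₂ N := by
  rw [bivariateKrawtchouk, bivariateKrawtchoukAt, quantumKrawtchouk_eq_of_isRegularSum hq0 hq1 h,
    quantumKrawtchouk_eq_of_isRegularSum hq0 hq1 (isRegularSum_sub_natCast hn)]

/-- No bound on `m₁ + m₂` is needed, so this also covers the points with `x₁ + x₂ = N + 1`, which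
occur in the 7-point equation with coefficient `0`. -/
theorem bivariateKrawtchouk_eq_of_natCast {q : ℝ} (hq0 : 0 < q) (hq1 : q < 1)
    {N n₁ n₂ : ℕ} (hn : n₁ + n₂ ≤ N) {x₁ x₂ : ℝ} (m₁ m₂ : ℕ) (h₁ : x₁ = m₁) (h₂ : x₂ = m₂)
    (α₁ α₂ : ℝ) :
    bivariateKrawtchouk q n₁ n₂ x₁ x₂ α₁ α₂ N = bivariateKrawtchoukAt q n₁ n₂ x₁ x₂ α₁ α₂ N := by
  have h := quantumKrawtchouk_eq_of_natCast hq0 hq1 n₁ (Nat.le_add_right m₁ m₂) (α₁ ^ (-2 : ℤ))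
  rw [Nat.cast_add] at h
  rw [bivariateKrawtchouk, bivariateKrawtchoukAt,
    quantumKrawtchouk_eq_of_isRegularSum hq0 hq1 (isRegularSum_sub_natCast hn), h₁, h₂, h]

/-- If `f` and `g` agree at the natural numbers, then so do their multiples by `1 - q^m` shifted to
`m - 1`: when `m = 0`, so that `m - 1` is not a natural number, the coefficient vanishes. -/
theorem one_sub_rpow_mul_congr {q : ℝ} {m : ℕ} {f g : ℝ → ℝ}
    (h : ∀ j : ℕ, f j = g j) :
    (1 - q ^ (m : ℝ)) * f (m - 1) = (1 - q ^ (m : ℝ)) * g (m - 1) := by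
  cases m with
  | zero => simp
  | succ j =>
    rw [show ((j + 1 : ℕ) : ℝ) - 1 = j by push_cast; ring, h]

/-! ### The 3-point and 7-point equations for the cleared polynomials -/

theorem bivariateKrawtchoukAt_three_point {q : ℝ} (hq0 : 0 < q) (hq1 : q < 1) {θ : ℝ}
    (hθ : θ ≠ 0) (φ : ℝ) (N n₁ n₂ : ℕ) {K : ℝ → ℝ → ℝ}
    (hK : ∀ x₁ x₂, K x₁ x₂ = bivariateKrawtchoukAt q n₁ n₂ x₁ x₂ θ φ N) (x₁ x₂ : ℝ) :
    q ^ n₁ * K x₁ x₂ =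
      (q ^ x₁ * (1 + θ ^ 2) + q⁻¹ * θ ^ 2 * q ^ (-x₂)
          - (1 + q⁻¹) * θ ^ 2 * q ^ (x₁ - x₂)) * K x₁ x₂
        + (1 - θ ^ 2 * q ^ (-x₂ - 1)) * (1 - q ^ x₁) * K (x₁ - 1) (x₂ + 1)
        + θ ^ 2 * q ^ (x₁ - x₂) * (1 - q ^ x₂) * K (x₁ + 1) (x₂ - 1) := by
  have hT : θ ^ 2 * θ ^ (-2 : ℤ) = 1 := by
    rw [zpow_neg, zpow_ofNat, mul_inv_cancel₀ (pow_ne_zero 2 hθ)]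
  have h := krawtchoukAt_difference hq0 hq1 n₁ hT x₁ (x₁ + x₂)
  rw [show x₁ - (x₁ + x₂) = -x₂ by ring, show 2 * x₁ - (x₁ + x₂) = x₁ - x₂ by ring,
    add_sub_cancel_left] at h
  simp only [hK, bivariateKrawtchoukAt]
  rw [show x₁ - 1 + (x₂ + 1) = x₁ + x₂ by ring, show x₁ + 1 + (x₂ - 1) = x₁ + x₂ by ring]
  linear_combination krawtchoukAt q n₂ (φ ^ (-2 : ℤ)) (x₁ + x₂ - n₁) ((N : ℝ) - n₁) * h

theorem bivariateKrawtchoukAt_seven_point {q : ℝ} (hq0 : 0 < q) (hq1 : q < 1) {θ φ : ℝ}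
    (hθ : θ ≠ 0) (hφ : φ ≠ 0) (N n₁ n₂ : ℕ) {K : ℝ → ℝ → ℝ}
    (hK : ∀ x₁ x₂, K x₁ x₂ = bivariateKrawtchoukAt q n₁ n₂ x₁ x₂ θ φ N) (x₁ x₂ : ℝ) :
    q ^ (n₁ + n₂) * K x₁ x₂ =
      (q ^ (x₁ + x₂) * (1 - (1 + q⁻¹) * φ ^ 2 * q ^ (x₁ + x₂ - N) + φ ^ 2)
          + q⁻¹ * φ ^ 2 * q ^ (2 * x₁ + x₂ - N) *
            (1 - (1 + q⁻¹) * θ ^ 2 * q ^ (-x₂) + θ ^ 2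
              + q⁻¹ * θ ^ 2 * q ^ (-(x₁ + x₂)))) * K x₁ x₂
        + φ ^ 2 * q ^ (x₁ + x₂ - N - 1) * (1 - q ^ x₁) * (1 - θ ^ 2 * q ^ (-x₂ - 1)) *
            K (x₁ - 1) (x₂ + 1)
        + θ ^ 2 * φ ^ 2 * q ^ (2 * x₁ - N - 1) * (1 - q ^ x₂) * K (x₁ + 1) (x₂ - 1)
        + q ^ x₁ * (1 - q ^ x₂) * (1 - φ ^ 2 * q ^ (x₁ + x₂ - N - 1)) * K x₁ (x₂ - 1)
        - φ ^ 2 * q ^ (x₁ + x₂) * (1 - q ^ (x₁ + x₂ - N)) * (1 - θ ^ 2 * q ^ (-x₂ - 1)) *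
            K x₁ (x₂ + 1)
        + (1 - q ^ x₁) * (1 - φ ^ 2 * q ^ (x₁ + x₂ - N - 1)) * K (x₁ - 1) x₂
        - θ ^ 2 * φ ^ 2 * q ^ (x₁ - 1) * (1 - q ^ (x₁ + x₂ - N)) * K (x₁ + 1) x₂ := by
  have hTθ : θ ^ 2 * θ ^ (-2 : ℤ) = 1 := by
    rw [zpow_neg, zpow_ofNat, mul_inv_cancel₀ (pow_ne_zero 2 hθ)]
  have hTφ : φ ^ 2 * φ ^ (-2 : ℤ) = 1 := by
    rw [zpow_neg, zpow_ofNat, mul_inv_cancel₀ (pow_ne_zero 2 hφ)]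
  have hA := krawtchoukAt_difference hq0 hq1 n₁ hTθ x₁ (x₁ + x₂)
  have hL := krawtchoukAt_lower hq0 n₁ (θ ^ (-2 : ℤ)) x₁ (x₁ + x₂)
  have hR := krawtchoukAt_raise hq0 hq1 n₁ hTθ x₁ (x₁ + x₂)
  have hB := krawtchoukAt_difference hq0 hq1 n₂ hTφ (x₁ + x₂ - n₁) ((N : ℝ) - n₁)
  simp only [hK, bivariateKrawtchoukAt]
  rw [show x₁ - 1 + (x₂ + 1) = x₁ + x₂ by ring, show x₁ + 1 + (x₂ - 1) = x₁ + x₂ by ring,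
    show x₁ + (x₂ - 1) = x₁ + x₂ - 1 by ring, show x₁ + (x₂ + 1) = x₁ + x₂ + 1 by ring,
    show x₁ - 1 + x₂ = x₁ + x₂ - 1 by ring, show x₁ + 1 + x₂ = x₁ + x₂ + 1 by ring,
    show x₁ + x₂ - 1 - (n₁ : ℝ) = x₁ + x₂ - n₁ - 1 by ring,
    show x₁ + x₂ + 1 - (n₁ : ℝ) = x₁ + x₂ - n₁ + 1 by ring]
  generalize krawtchoukAt q n₁ (θ ^ (-2 : ℤ)) x₁ (x₁ + x₂) = A at *
  generalize krawtchoukAt q n₁ (θ ^ (-2 : ℤ)) (x₁ - 1) (x₁ + x₂) = A₁ at *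
  generalize krawtchoukAt q n₁ (θ ^ (-2 : ℤ)) (x₁ + 1) (x₁ + x₂) = A₂ at *
  generalize krawtchoukAt q n₁ (θ ^ (-2 : ℤ)) x₁ (x₁ + x₂ - 1) = A₃ at *
  generalize krawtchoukAt q n₁ (θ ^ (-2 : ℤ)) (x₁ - 1) (x₁ + x₂ - 1) = A₄ at *
  generalize krawtchoukAt q n₁ (θ ^ (-2 : ℤ)) x₁ (x₁ + x₂ + 1) = A₅ at *
  generalize krawtchoukAt q n₁ (θ ^ (-2 : ℤ)) (x₁ + 1) (x₁ + x₂ + 1) = A₆ at *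
  generalize krawtchoukAt q n₂ (φ ^ (-2 : ℤ)) (x₁ + x₂ - n₁) ((N : ℝ) - n₁) = B at *
  generalize krawtchoukAt q n₂ (φ ^ (-2 : ℤ)) (x₁ + x₂ - n₁ - 1) ((N : ℝ) - n₁) = B₁ at *
  generalize krawtchoukAt q n₂ (φ ^ (-2 : ℤ)) (x₁ + x₂ - n₁ + 1) ((N : ℝ) - n₁) = B₂ at *
  have hq := hq0.ne'
  have hu := (Real.rpow_pos_of_pos hq0 x₁).ne'
  have hv := (Real.rpow_pos_of_pos hq0 x₂).ne'
  have e2 (y : ℝ) : q ^ (2 * y) = q ^ y * q ^ y := by rw [two_mul, Real.rpow_add hq0]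
  have hn := pow_ne_zero n₁ hq
  have hN := pow_ne_zero N hq
  simp only [Real.rpow_sub hq0, Real.rpow_add hq0, Real.rpow_neg hq0.le, Real.rpow_one, e2,
    Real.rpow_natCast, pow_add] at hA hL hR hB ⊢
  generalize q ^ x₁ = u at *
  generalize q ^ x₂ = v at *
  generalize q ^ n₁ = a at *
  generalize q ^ N = M at *
  -- The second term rewrites the summand `q⁻¹ φ² q^{x₁+x₂-N}` of the coefficient of `q^{n₁} A B`;
  -- the last two rewrite the coefficients of `B₁` and `B₂`.
  linear_combination (norm := (field_simp; ring)) a * A * hB + q⁻¹ * φ ^ 2 * (u * v / M) * B * hA +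
    (1 - φ ^ 2 * (u * v / M / q)) * B₁ * hL - φ ^ 2 * (u * v) * (1 - u * v / M) * B₂ * hR

end QKrawtchouk

/-! ### Transfer to the bivariate quantum q-Krawtchouk polynomials -/

theorem mainTheorem7 (q : ℝ) (hq0 : 0 < q) (hq1 : q < 1) (θ φ : ℝ) (hθ : θ ≠ 0) (hφ : φ ≠ 0)
    (N n₁ n₂ : ℕ) (hn : n₁ + n₂ ≤ N) (K : ℝ → ℝ → ℝ)
    (hK : ∀ x₁ x₂ : ℝ, K x₁ x₂ = QKrawtchouk.bivariateKrawtchouk q n₁ n₂ x₁ x₂ θ φ N) :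
    -- the 3-point equation
    (∀ x₁ x₂ : ℝ,
      (QKrawtchouk.IsGridPoint N x₁ x₂ ∨ QKrawtchouk.IsRegularSum n₁ (x₁ + x₂)) →
      q ^ n₁ * K x₁ x₂ =
        (q ^ x₁ * (1 + θ ^ 2) + q⁻¹ * θ ^ 2 * q ^ (-x₂)
            - (1 + q⁻¹) * θ ^ 2 * q ^ (x₁ - x₂)) * K x₁ x₂
          + (1 - θ ^ 2 * q ^ (-x₂ - 1)) * (1 - q ^ x₁) * K (x₁ - 1) (x₂ + 1)
          + θ ^ 2 * q ^ (x₁ - x₂) * (1 - q ^ x₂) * K (x₁ + 1) (x₂ - 1)) ∧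
    -- the 7-point equation
    (∀ x₁ x₂ : ℝ,
      (QKrawtchouk.IsGridPoint N x₁ x₂ ∨
        (QKrawtchouk.IsRegularSum n₁ (x₁ + x₂ - 1) ∧ QKrawtchouk.IsRegularSum n₁ (x₁ + x₂) ∧
          QKrawtchouk.IsRegularSum n₁ (x₁ + x₂ + 1))) →
      q ^ (n₁ + n₂) * K x₁ x₂ =
        (q ^ (x₁ + x₂) * (1 - (1 + q⁻¹) * φ ^ 2 * q ^ (x₁ + x₂ - N) + φ ^ 2)
            + q⁻¹ * φ ^ 2 * q ^ (2 * x₁ + x₂ - N) *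
              (1 - (1 + q⁻¹) * θ ^ 2 * q ^ (-x₂) + θ ^ 2
                + q⁻¹ * θ ^ 2 * q ^ (-(x₁ + x₂)))) * K x₁ x₂
          + φ ^ 2 * q ^ (x₁ + x₂ - N - 1) * (1 - q ^ x₁) * (1 - θ ^ 2 * q ^ (-x₂ - 1)) *
              K (x₁ - 1) (x₂ + 1)
          + θ ^ 2 * φ ^ 2 * q ^ (2 * x₁ - N - 1) * (1 - q ^ x₂) * K (x₁ + 1) (x₂ - 1)
          + q ^ x₁ * (1 - q ^ x₂) * (1 - φ ^ 2 * q ^ (x₁ + x₂ - N - 1)) * K x₁ (x₂ - 1)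
          - φ ^ 2 * q ^ (x₁ + x₂) * (1 - q ^ (x₁ + x₂ - N)) * (1 - θ ^ 2 * q ^ (-x₂ - 1)) *
              K x₁ (x₂ + 1)
          + (1 - q ^ x₁) * (1 - φ ^ 2 * q ^ (x₁ + x₂ - N - 1)) * K (x₁ - 1) x₂
          - θ ^ 2 * φ ^ 2 * q ^ (x₁ - 1) * (1 - q ^ (x₁ + x₂ - N)) * K (x₁ + 1) x₂) := by
  let P : ℝ → ℝ → ℝ := fun x₁ x₂ => QKrawtchouk.bivariateKrawtchoukAt q n₁ n₂ x₁ x₂ θ φ N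
  have hP3 := QKrawtchouk.bivariateKrawtchoukAt_three_point hq0 hq1 hθ φ N n₁ n₂
    (K := P) (fun _ _ => rfl)
  have hP7 := QKrawtchouk.bivariateKrawtchoukAt_seven_point hq0 hq1 hθ hφ N n₁ n₂
    (K := P) (fun _ _ => rfl)
  have hreg : ∀ {x₁ x₂ : ℝ}, QKrawtchouk.IsRegularSum n₁ (x₁ + x₂) → K x₁ x₂ = P x₁ x₂ :=
    fun h => (hK _ _).trans
      (QKrawtchouk.bivariateKrawtchouk_eq_of_isRegularSum hq0 hq1 hn h θ φ)
  have hnat : ∀ {x₁ x₂ : ℝ} (m₁ m₂ : ℕ), x₁ = m₁ → x₂ = m₂ → K x₁ x₂ = P x₁ x₂ :=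
    fun m₁ m₂ h₁ h₂ => (hK _ _).trans
      (QKrawtchouk.bivariateKrawtchouk_eq_of_natCast hq0 hq1 hn m₁ m₂ h₁ h₂ θ φ)
  constructor
  · intro x₁ x₂ h
    specialize hP3 x₁ x₂
    rcases h with ⟨m₁, m₂, -, rfl, rfl⟩ | h
    · have h0 : K m₁ m₂ = P m₁ m₂ := hnat m₁ m₂ rfl rfl
      have h1 : (1 - q ^ (m₁ : ℝ)) * K (m₁ - 1) (m₂ + 1) =
          (1 - q ^ (m₁ : ℝ)) * P (m₁ - 1) (m₂ + 1) :=
        QKrawtchouk.one_sub_rpow_mul_congr (f := fun y => K y (m₂ + 1))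
          (g := fun y => P y (m₂ + 1)) fun j => hnat j (m₂ + 1) rfl (by push_cast; rfl)
      have h2 : (1 - q ^ (m₂ : ℝ)) * K (m₁ + 1) (m₂ - 1) =
          (1 - q ^ (m₂ : ℝ)) * P (m₁ + 1) (m₂ - 1) :=
        QKrawtchouk.one_sub_rpow_mul_congr (f := fun y => K (m₁ + 1) y)
          (g := fun y => P (m₁ + 1) y) fun j => hnat (m₁ + 1) j (by push_cast; rfl) rfl
      rw [h0]
      linear_combination hP3 - (1 - θ ^ 2 * q ^ (-(m₂ : ℝ) - 1)) * h1
        - θ ^ 2 * q ^ ((m₁ : ℝ) - m₂) * h2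
    · rwa [hreg h, hreg (x₁ := x₁ - 1) (x₂ := x₂ + 1) (by convert h using 1; ring),
        hreg (x₁ := x₁ + 1) (x₂ := x₂ - 1) (by convert h using 1; ring)]
  · intro x₁ x₂ h
    specialize hP7 x₁ x₂
    rcases h with ⟨m₁, m₂, -, rfl, rfl⟩ | ⟨hm, h, hp⟩
    · have h0 : K m₁ m₂ = P m₁ m₂ := hnat m₁ m₂ rfl rfl
      have h1 : (1 - q ^ (m₁ : ℝ)) * K (m₁ - 1) (m₂ + 1) =
          (1 - q ^ (m₁ : ℝ)) * P (m₁ - 1) (m₂ + 1) :=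
        QKrawtchouk.one_sub_rpow_mul_congr (f := fun y => K y (m₂ + 1))
          (g := fun y => P y (m₂ + 1)) fun j => hnat j (m₂ + 1) rfl (by push_cast; rfl)
      have h2 : (1 - q ^ (m₂ : ℝ)) * K (m₁ + 1) (m₂ - 1) =
          (1 - q ^ (m₂ : ℝ)) * P (m₁ + 1) (m₂ - 1) :=
        QKrawtchouk.one_sub_rpow_mul_congr (f := fun y => K (m₁ + 1) y)
          (g := fun y => P (m₁ + 1) y) fun j => hnat (m₁ + 1) j (by push_cast; rfl) rfl
      have h3 : (1 - q ^ (m₂ : ℝ)) * K m₁ (m₂ - 1) = (1 - q ^ (m₂ : ℝ)) * P m₁ (m₂ - 1) :=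
        QKrawtchouk.one_sub_rpow_mul_congr (f := fun y => K m₁ y)
          (g := fun y => P m₁ y) fun j => hnat m₁ j rfl rfl
      have h4 : (1 - q ^ (m₁ : ℝ)) * K (m₁ - 1) m₂ = (1 - q ^ (m₁ : ℝ)) * P (m₁ - 1) m₂ :=
        QKrawtchouk.one_sub_rpow_mul_congr (f := fun y => K y m₂)
          (g := fun y => P y m₂) fun j => hnat j m₂ rfl rfl
      have h5 : K m₁ (m₂ + 1) = P m₁ (m₂ + 1) := hnat m₁ (m₂ + 1) rfl (by push_cast; rfl)
      have h6 : K (m₁ + 1) m₂ = P (m₁ + 1) m₂ := hnat (m₁ + 1) m₂ (by push_cast; rfl) rfl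
      rw [h0, h5, h6]
      linear_combination hP7
        - φ ^ 2 * q ^ ((m₁ : ℝ) + m₂ - N - 1) * (1 - θ ^ 2 * q ^ (-(m₂ : ℝ) - 1)) * h1
        - θ ^ 2 * φ ^ 2 * q ^ (2 * (m₁ : ℝ) - N - 1) * h2
        - q ^ (m₁ : ℝ) * (1 - φ ^ 2 * q ^ ((m₁ : ℝ) + m₂ - N - 1)) * h3
        - (1 - φ ^ 2 * q ^ ((m₁ : ℝ) + m₂ - N - 1)) * h4
    · rwa [hreg h, hreg (x₁ := x₁ - 1) (x₂ := x₂ + 1) (by convert h using 1; ring),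
        hreg (x₁ := x₁ + 1) (x₂ := x₂ - 1) (by convert h using 1; ring),
        hreg (x₁ := x₁) (x₂ := x₂ - 1) (by convert hm using 1; ring),
        hreg (x₁ := x₁) (x₂ := x₂ + 1) (by convert hp using 1; ring),
        hreg (x₁ := x₁ - 1) (x₂ := x₂) (by convert hm using 1; ring),
        hreg (x₁ := x₁ + 1) (x₂ := x₂) (by convert hp using 1; ring)]
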